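/- Let $K$ be a field. For a small category $\mathcal{C}$, let $\mathrm{mod}\,\mathcal{C}$ be the category of functors $M:\mathcal{C}\to\mathrm{vect}_K$ to finite-dimensional $K$-vector spaces (pointwise finite-dimensional $\mathcal{C}$-modules), and let $K_{\mathcal{C}}\in\mathrm{mod}\,\mathcal{C}$ be the constant functor with value $K$ and identity maps. Every $M\in\mathrm{mod}\,\mathcal{C}$ is a (pointwise) direct sum of indecomposable modules, uniquely up to isomorphism and order of the summands; for $U$ indecomposable, $\mathrm{mult}(M,U)$ is the number of summands isomorphic to $U$ in such a decomposition. Posets are regarded as categories, with a unique morphism $p\to q$ when $p\le q$; connected means nonempty and connected by zigzags. A functor $F:\mathcal{S}\to\mathcal{P}$ is final (resp. initial) if for every $p\in\mathcal{P}$ the comma category $p/F$ (resp. $F/p$) is nonempty and connected. For a subset $\mathcal{A}$ of a poset, $\max\mathcal{A}$ and $\min\mathcal{A}$ denote its sets of maximal and minimal elements with respect to the induced order. Say that a nonempty poset $\mathcal{P}$ satisfies (Fin) if (1) there is a finite subset $T\subseteq\mathcal{P}$ such that every $p\in\mathcal{P}$ satisfies $p\le t$ for some $t\in T$; and (2) for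 all subsets $\mathcal{A},\mathcal{B}\subseteq\mathcal{P}$ with $\mathcal{A}\cap\mathcal{B}\ne\emptyset$, $\max\mathcal{A}\neq\emptyset$ and $\max\mathcal{B}\ne\emptyset$, one has $\max(\mathcal{A}\cap\mathcal{B})\neq\emptyset$. Say that $\mathcal{P}$ satisfies (Fin$^{*}$) if the opposite poset satisfies (Fin), i.e. if the same conditions hold with $\le$ replaced by $\ge$ and $\max$ by $\min$. Proposition. Let $\mathcal{S}$ and $\mathcal{P}$ be connected posets and let $F:\mathcal{S}\to\mathcal{P}$ be a full poset morphism, i.e. $s\le t$ in $\mathcal{S}$ if and only if $F(s)\le F(t)$ in $\mathcal{P}$. Suppose that $\mathrm{mult}(M,K_{\mathcal{P}})=\mathrm{mult}(MF,K_{\mathcal{S}})$ for all $M\in\mathrm{mod}\,\mathcal{P}$, where $MF=M\circ F$. If $\mathcal{P}$ satisfies (Fin), then $F$ is final; if $\mathcal{P}$ satisfies (Fin$^{*}$), then $F$ is initial. -/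

import Mathlib

open CategoryTheory

noncomputable section

namespace PersMod

universe u v w

/-- `mod C`: the category of pointwise finite-dimensional `C`-modules, i.e. functors from `C` to
finite-dimensional `K`-vector spaces. -/
abbrev PfdModule (K : Type w) [Field K] (C : Type u) [Category.{v} C] :=
  C ⥤ FGModuleCat.{w} K

/-- The entire interval module `K_C`: it is `K` at every object and the identity on every
morphism. -/
abbrev entireIntervalModule (K : Type w) [Field K] (C : Type u) [Category.{v} C] :
    PfdModule K C :=
  (Functor.const C).obj (FGModuleCat.of K K)

/-- The linear map `M(c) → N(c)` underlying a morphism of modules `M ⟶ N` at an object `c`. -/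
def appLinear {K : Type w} [Field K] {C : Type u} [Category.{v} C] {M N : PfdModule K C}
    (f : M ⟶ N) (c : C) : M.obj c →ₗ[K] N.obj c :=
  (f.app c).hom.hom

open Classical in
/-- A decomposition of `M` as a direct sum of indecomposable modules. Direct sums of modules are
formed pointwise: at each object `c`, the map `⨁ i, M_i(c) → M(c)` induced by the natural maps
`M_i ⟶ M` is bijective. (Since `M` is pointwise finite-dimensional, at each object only finitely many
nonzero indecomposables contribute, so index sets in the universe of the objects of `C` are enough.) -/
structure IndecomposableDecomposition {K : Type w} [Field K] {C : Type u} [Category.{v} C]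
    (M : PfdModule K C) where
  /-- the index set -/
  ι : Type u
  /-- the summands -/
  summand : ι → PfdModule K C
  /-- every summand is indecomposable (in particular nonzero) -/
  indecomposable : ∀ i, Indecomposable (summand i)
  /-- the inclusions of the summands -/
  incl : ∀ i, summand i ⟶ M
  /-- `M` is the pointwise direct sum of the summands -/
  bijective : ∀ c : C, Function.Bijective
    (DirectSum.toModule K ι (M.obj c) (fun i => appLinear (incl i) c))

open Classical in
/-- `mult(M, U)`: the number of summands isomorphic to `U` in a decomposition of `M` into
indecomposables. By the Krull–Schmidt property every `M` has such a decomposition, and the number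
does not depend on which one is chosen. -/
def mult {K : Type w} [Field K] {C : Type u} [Category.{v} C] (M U : PfdModule K C) : ℕ :=
  if h : Nonempty (IndecomposableDecomposition M) then
    Nat.card {i : h.some.ι // Nonempty (h.some.summand i ≅ U)}
  else 0

/-- The set `max A` of maximal elements of a subset `A` of a poset. -/
def maxSet {P : Type u} [PartialOrder P] (A : Set P) : Set P := {a | Maximal (· ∈ A) a}

/-- The set `min A` of minimal elements of a subset `A` of a poset. -/
def minSet {P : Type u} [PartialOrder P] (A : Set P) : Set P := {a | Minimal (· ∈ A) a}

/-- The finiteness assumption on a poset `P`. -/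
structure FinitenessAssumption (P : Type u) [PartialOrder P] : Prop where
  nonempty : Nonempty P
  /-- `P` is the downset of a finite subset -/
  downset : ∃ T : Set P, T.Finite ∧ ∀ p : P, ∃ t ∈ T, p ≤ t
  maximality : ∀ A B : Set P, (A ∩ B).Nonempty → (maxSet A).Nonempty → (maxSet B).Nonempty →
    (maxSet (A ∩ B)).Nonempty

/-- The dual finiteness assumption on a poset `P`. -/
structure DualFinitenessAssumption (P : Type u) [PartialOrder P] : Prop where
  nonempty : Nonempty P
  /-- `P` is the upset of a finite subset -/
  upset : ∃ T : Set P, T.Finite ∧ ∀ p : P, ∃ t ∈ T, t ≤ p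
  minimality : ∀ A B : Set P, (A ∩ B).Nonempty → (minSet A).Nonempty → (minSet B).Nonempty →
    (minSet (A ∩ B)).Nonempty

end PersMod

end

noncomputable section

namespace PersMod

universe u v w

/-! ### Direct sums and one-dimensional spaces. -/

section DirectSum

variable {K : Type*} [Field K] {ι : Type*} [DecidableEq ι] {M : ι → Type*}
  [∀ i, AddCommGroup (M i)] [∀ i, Module K (M i)] {V : Type*} [AddCommGroup V] [Module K V]
  {φ : ∀ i, M i →ₗ[K] V}

/-! If `F` is not final, some `M` restricts to `K_S` without having `K_P` as a summand. Take `M` to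
be the functions on a presheaf `I` of finite sets that has one point over each `F.obj s`; then `F ⋙
M` is `K_S`, of multiplicity one. If `K_P` also had nonzero multiplicity in `M`, it would be a
retract of `M`. This fails if at some `p` every point of `I` misses the image of restriction from
some `q ≥ p`: a map `M ⟶ K_P` then kills every indicator function at `p`.

Such an `I` comes from `exists_finitePresheaf`. (Fin) gives a top element or maximal elements in all
nonempty subsets. If `F` is cofinal but not final, a top is impossible, so there is a maximal `p`
with disconnected comma category. Two points over `p` record the two sides of a disconnection, and
maximality of `p` makes the side well defined above `p`.

The initial case uses the same combinatorics on `Pᵒᵈ`, with free modules instead of function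
modules. -/

theorem injective_of_injective_toModule
    (h : Function.Injective (DirectSum.toModule K ι V φ)) (i : ι) :
    Function.Injective (φ i) := by
  intro x y hxy
  apply DirectSum.of_injective (β := M) i
  apply h
  have key : ∀ z, DirectSum.toModule K ι V φ (DirectSum.of M i z) = φ i z :=
    fun z => DirectSum.toModule_lof K i z
  rw [key, key, hxy]

/-- If a one-dimensional space is a direct sum, then exactly one summand is nonzero. -/
theorem existsUnique_summand_ne_zero (hV : Module.finrank K V = 1)
    (h : Function.Bijective (DirectSum.toModule K ι V φ)) : ∃! i, φ i ≠ 0 := by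
  have key : ∀ i z, DirectSum.toModule K ι V φ (DirectSum.of M i z) = φ i z :=
    fun i z => DirectSum.toModule_lof K i z
  have hex : ∃ i, φ i ≠ 0 := by
    by_contra! hzero
    have : Nontrivial V := Module.nontrivial_of_finrank_pos (R := K) (by omega)
    obtain ⟨y, hy⟩ := exists_ne (0 : V)
    obtain ⟨z, rfl⟩ := h.2 y
    apply hy
    have : DirectSum.toModule K ι V φ = 0 := by
      apply DirectSum.linearMap_ext
      intro i
      ext x
      simp [hzero i]
    rw [this, LinearMap.zero_apply]
  obtain ⟨i, hi⟩ := hex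
  refine ⟨i, hi, fun j hj => ?_⟩
  by_contra hij
  obtain ⟨x, hx⟩ := DFunLike.ne_iff.mp hi
  obtain ⟨y, hy⟩ := DFunLike.ne_iff.mp hj
  obtain ⟨c, hc⟩ := exists_smul_eq_of_finrank_eq_one hV hy (φ i x)
  have hinj : DirectSum.of M j (c • y) = DirectSum.of M i x := by
    apply h.1
    rw [key, key, map_smul, hc]
  have hx0 : x = 0 := by
    have := congrArg (fun z => z i) hinj
    simpa [DirectSum.of_eq_of_ne _ _ _ (Ne.symm hij), DirectSum.of_eq_same] using this.symm
  exact hx (by simp [hx0])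

theorem bijective_toModule_punit [inst : DecidableEq PUnit.{u + 1}] {W : Type*} [AddCommGroup W]
    [Module K W] (e : W ≃ₗ[K] V) :
    Function.Bijective (DirectSum.toModule K PUnit.{u + 1} V fun _ => e.toLinearMap) := by
  -- Decompositions carry the classical instance, `DirectSum.lid` the standard one.
  obtain rfl : inst = instDecidableEqPUnit := Subsingleton.elim _ _
  have h : DirectSum.toModule K PUnit.{u + 1} V (fun _ => e.toLinearMap) =
      e.toLinearMap ∘ₗ (DirectSum.lid K W PUnit.{u + 1}).toLinearMap := by
    apply DirectSum.linearMap_ext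
    intro i
    ext
    simp [DirectSum.lid]
  rw [h]
  exact e.bijective.comp (DirectSum.lid K W PUnit).bijective

end DirectSum

/-! ### Multiplicity of the entire interval module. -/

section Multiplicity

variable {K : Type w} [Field K] {C : Type u} [Category.{v} C]

theorem appLinear_comp {L M N : PfdModule K C} (f : L ⟶ M) (g : M ⟶ N) (c : C) :
    appLinear (f ≫ g) c = appLinear g c ∘ₗ appLinear f c := rfl

theorem appLinear_id (M : PfdModule K C) (c : C) : appLinear (𝟙 M) c = LinearMap.id := rfl

theorem appLinear_naturality {M N : PfdModule K C} (f : M ⟶ N) {c d : C} (g : c ⟶ d)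
    (x : M.obj c) :
    appLinear f d ((M.map g).hom.hom x) = (N.map g).hom.hom (appLinear f c x) :=
  congrArg (fun t => t.hom.hom x) (f.naturality g)

/-- The pointwise linear isomorphisms underlying an isomorphism of modules. -/
def appLinearEquiv {M N : PfdModule K C} (e : M ≅ N) (c : C) : M.obj c ≃ₗ[K] N.obj c :=
  LinearEquiv.ofLinearMap (appLinear e.hom c) (appLinear e.inv c)
    (by rw [← appLinear_comp, e.inv_hom_id, appLinear_id])
    (by rw [← appLinear_comp, e.hom_inv_id, appLinear_id])

theorem isIso_of_bijective {M N : PfdModule K C} (f : M ⟶ N)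
    (h : ∀ c, Function.Bijective (appLinear f c)) : IsIso f := by
  have (c : C) : IsIso (f.app c) :=
    (LinearEquiv.toFGModuleCatIso (LinearEquiv.ofBijective (appLinear f c) (h c))).isIso_hom
  exact NatIso.isIso_of_isIso_app f

/-- By connectedness an endomorphism is determined by one scalar, so the idempotent of a splitting
is 0 or 1. -/
theorem indecomposable_entireIntervalModule [IsConnected C] :
    Indecomposable (entireIntervalModule K C) := by
  obtain ⟨c⟩ : Nonempty C := inferInstance
  have eval_inj : ∀ f g : entireIntervalModule K C ⟶ entireIntervalModule K C,
      appLinear f c (1 : K) = appLinear g c (1 : K) → f = g := by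
    intro f g hfg
    have hc : f.app c = g.app c := by
      apply FGModuleCat.hom_ext
      apply LinearMap.ext_ring
      exact hfg
    ext1
    funext d
    have := nat_trans_from_is_connected f c d
    have := nat_trans_from_is_connected g c d
    simp_all
  refine ⟨fun hzero => ?_, fun Y Z e => ?_⟩
  · have h := congrArg (fun f => appLinear f c (1 : K))
      (hzero.eq_of_src (𝟙 _) (0 : entireIntervalModule K C ⟶ _))
    exact one_ne_zero (α := K) h
  · set p : entireIntervalModule K C ⟶ entireIntervalModule K C :=
      e.hom ≫ Limits.biprod.fst ≫ Limits.biprod.inl ≫ e.inv with hp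
    have hpp : p ≫ p = p := by simp [hp]
    set k : K := appLinear p c (1 : K) with hk
    have hkk : k * k = k := by
      have h : appLinear p c (appLinear p c (1 : K)) = appLinear p c (1 : K) :=
        congrArg (fun f => appLinear f c (1 : K)) hpp
      have h' : appLinear p c (k • (1 : K)) = k • appLinear p c (1 : K) := map_smul _ _ _
      rw [smul_eq_mul, mul_one] at h'
      exact h'.symm.trans h
    rcases IsIdempotentElem.iff_eq_zero_or_one.mp hkk with hk0 | hk1
    · left
      have hp0 : p = 0 := eval_inj _ _ hk0
      rw [Limits.IsZero.iff_id_eq_zero]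
      have : (Limits.biprod.inl ≫ e.inv) ≫ p ≫ e.hom ≫ Limits.biprod.fst = 𝟙 Y := by simp [hp]
      rw [← this, hp0]
      simp
    · right
      have hp1 : p = 𝟙 _ := eval_inj _ _ hk1
      rw [Limits.IsZero.iff_id_eq_zero]
      have : (Limits.biprod.inr ≫ e.inv) ≫ p ≫ e.hom ≫ Limits.biprod.snd = 0 := by simp [hp]
      rw [hp1] at this
      simpa using this

open Classical in
/-- The decomposition with one summand of a module isomorphic to `K_C`. -/
def decompositionOfIso [IsConnected C] {N : PfdModule K C} (e : N ≅ entireIntervalModule K C) :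
    IndecomposableDecomposition N where
  ι := PUnit
  summand _ := entireIntervalModule K C
  indecomposable _ := indecomposable_entireIntervalModule
  incl _ := e.inv
  bijective c := bijective_toModule_punit
    (inst := fun a b => Classical.propDecidable (a = b)) (appLinearEquiv e.symm c)

open Classical in
-- At each object exactly one summand maps nontrivially. Its index is constant by connectedness,
-- since the transition maps of `N` are injective, and its inclusion is an isomorphism.
theorem mult_eq_one_of_iso [IsConnected C] {N : PfdModule K C}
    (e : N ≅ entireIntervalModule K C) : mult N (entireIntervalModule K C) = 1 := by
  rw [mult, dif_pos ⟨decompositionOfIso e⟩]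
  generalize Nonempty.some _ = D
  have hrank (c : C) : Module.finrank K (N.obj c) = 1 :=
    (appLinearEquiv e c).finrank_eq.trans (Module.finrank_self K)
  have huniq (c : C) := existsUnique_summand_ne_zero (hrank c) (D.bijective c)
  have hinj (i : D.ι) (c : C) : Function.Injective (appLinear (D.incl i) c) :=
    injective_of_injective_toModule (D.bijective c).1 i
  choose idx hidx hidx_unique using huniq
  have hmap {c d : C} (f : c ⟶ d) : Function.Injective (N.map f).hom.hom := by
    intro x y hxy
    apply (appLinearEquiv e c).injective
    have h := congrArg (appLinear e.hom d) hxy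
    rw [appLinear_naturality, appLinear_naturality] at h
    exact h
  have hconst : ∀ c d, idx c = idx d := by
    apply constant_of_preserves_morphisms
    intro c d f
    apply hidx_unique d
    obtain ⟨x, hx⟩ := DFunLike.ne_iff.mp (hidx c)
    refine DFunLike.ne_iff.mpr ⟨((D.summand (idx c)).map f).hom.hom x, ?_⟩
    rw [appLinear_naturality]
    intro h
    exact hx (hmap f (h.trans (map_zero _).symm))
  obtain ⟨c⟩ : Nonempty C := inferInstance
  have hiso : IsIso (D.incl (idx c)) := by
    apply isIso_of_bijective
    intro d
    refine ⟨hinj _ d, fun y => ?_⟩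
    have hd := hidx d
    rw [← hconst c d] at hd
    obtain ⟨x, hx⟩ := DFunLike.ne_iff.mp hd
    obtain ⟨k, hk⟩ := exists_smul_eq_of_finrank_eq_one (hrank d) hx y
    exact ⟨k • x, by rw [map_smul, hk]⟩
  have hsub : ∀ i, Nonempty (D.summand i ≅ entireIntervalModule K C) → i = idx c := by
    rintro i ⟨e'⟩
    apply hidx_unique c
    refine DFunLike.ne_iff.mpr ⟨(appLinearEquiv e' c).symm (1 : K), fun h => ?_⟩
    have h0 := hinj i c (h.trans (map_zero _).symm)
    exact one_ne_zero (α := K) ((LinearEquiv.map_eq_zero_iff _).mp h0)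
  rw [Nat.card_eq_one_iff_unique]
  exact ⟨⟨fun a b => Subtype.ext ((hsub a a.2).trans (hsub b b.2).symm)⟩,
    ⟨⟨idx c, ⟨asIso (D.incl (idx c)) ≪≫ e⟩⟩⟩⟩

open Classical in
/-- The projection onto a summand of a decomposition. -/
def IndecomposableDecomposition.proj {M : PfdModule K C} (D : IndecomposableDecomposition M)
    (i : D.ι) : M ⟶ D.summand i where
  app c := FGModuleCat.ofHom (DirectSum.component K D.ι (fun j => (D.summand j).obj c) i ∘ₗ
    (LinearEquiv.ofBijective _ (D.bijective c)).symm.toLinearMap)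
  naturality c d f := by
    apply FGModuleCat.hom_ext
    ext x
    obtain ⟨z, rfl⟩ := (LinearEquiv.ofBijective _ (D.bijective c)).surjective x
    simp only [FGModuleCat.hom_hom_comp, LinearMap.comp_apply]
    change DirectSum.component K D.ι (fun j => (D.summand j).obj d) i
        ((LinearEquiv.ofBijective _ (D.bijective d)).symm ((M.map f).hom.hom _)) =
      ((D.summand i).map f).hom.hom
        (DirectSum.component K D.ι (fun j => (D.summand j).obj c) i
          ((LinearEquiv.ofBijective _ (D.bijective c)).symm _))
    rw [LinearEquiv.symm_apply_apply]
    -- Transition maps of `M` act summandwise; this is checked on generators.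
    have h : (M.map f).hom.hom (LinearEquiv.ofBijective _ (D.bijective c) z) =
        LinearEquiv.ofBijective _ (D.bijective d)
          (DirectSum.lmap (fun j => ((D.summand j).map f).hom.hom) z) := by
      induction z using DirectSum.induction_on with
      | zero => simp
      | of j y =>
        have h1 := DirectSum.toModule_lof K (M := fun j => (D.summand j).obj c)
          (φ := fun i => appLinear (D.incl i) c) j y
        have h2 := DirectSum.toModule_lof K (M := fun j => (D.summand j).obj d)
          (φ := fun i => appLinear (D.incl i) d) j (((D.summand j).map f).hom.hom y)
        have h3 := DirectSum.lmap_lof (fun j => ((D.summand j).map f).hom.hom) j y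
        rw [← DirectSum.lof_eq_of K, h3, LinearEquiv.ofBijective_apply,
          LinearEquiv.ofBijective_apply, h1, h2, appLinear_naturality]
      | add a b ha hb => simp only [map_add, ha, hb]
    rw [h, LinearEquiv.symm_apply_apply]
    rfl

theorem IndecomposableDecomposition.incl_proj {M : PfdModule K C}
    (D : IndecomposableDecomposition M) (i : D.ι) : D.incl i ≫ D.proj i = 𝟙 _ := by
  classical
  ext1
  funext c
  apply FGModuleCat.hom_ext
  ext x
  change DirectSum.component K D.ι (fun j => (D.summand j).obj c) i
    ((LinearEquiv.ofBijective _ (D.bijective c)).symm (appLinear (D.incl i) c x)) = x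
  have h1 := DirectSum.toModule_lof K (M := fun j => (D.summand j).obj c)
    (φ := fun i => appLinear (D.incl i) c) i x
  rw [← h1]
  erw [LinearEquiv.ofBijective_symm_apply_apply]
  exact DirectSum.component.lof_self K (M := fun j => (D.summand j).obj c) i x

/-- A module in whose decompositions `U` occurs has `U` as a retract. -/
theorem nonempty_retract_of_mult_ne_zero {M U : PfdModule K C} (h : mult M U ≠ 0) :
    Nonempty (Retract U M) := by
  rw [mult] at h
  -- Nonzero multiplicity excludes the default value 0, so a decomposition exists without appeal to
  -- Krull–Schmidt.
  split_ifs at h with hD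
  · obtain ⟨⟨i, ⟨e⟩⟩⟩ := (Nat.card_ne_zero.mp h).1
    exact ⟨⟨e.inv ≫ hD.some.incl i, hD.some.proj i ≫ e.hom, by
      rw [Category.assoc, ← Category.assoc (hD.some.incl i), hD.some.incl_proj, Category.id_comp,
        e.inv_hom_id]⟩⟩
  · exact absurd rfl h

end Multiplicity

/-! ### Consequences of (Fin) and the construction of the presheaf. -/

section Order

variable {P : Type*} [PartialOrder P]

/-- Without a top there are two distinct maximal elements `t`, `t'` of `P`. If `X` has no maximal
element, adjoining `t` or `t'` gives sets that have one, yet they intersect in `X`. -/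
theorem exists_top_or_exists_maximal (h : FinitenessAssumption P) :
    (∃ t : P, ∀ p, p ≤ t) ∨ ∀ X : Set P, X.Nonempty → ∃ x, Maximal (· ∈ X) x := by
  by_contra! hcon
  obtain ⟨hcon, X, hX, hmax⟩ := hcon
  obtain ⟨T, hT, hle⟩ := h.downset
  obtain ⟨p₀⟩ := h.nonempty
  have above (p : P) : ∃ t, p ≤ t ∧ ∀ q, t ≤ q → q = t := by
    obtain ⟨t', ht', hpt'⟩ := hle p
    obtain ⟨t, htt, ht⟩ := hT.exists_le_maximal ht'
    refine ⟨t, hpt'.trans htt, fun q hq => ?_⟩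
    obtain ⟨t'', ht'', hqt⟩ := hle q
    exact le_antisymm (hqt.trans (ht.2 ht'' (hq.trans hqt))) hq
  obtain ⟨t, -, ht⟩ := above p₀
  obtain ⟨p, hp⟩ := hcon t
  obtain ⟨t', hpt', ht'⟩ := above p
  have hne : t ≠ t' := fun heq => hp (heq ▸ hpt')
  have hmem (s : P) (hs : ∀ q, s ≤ q → q = s) : s ∈ maxSet (insert s X) :=
    ⟨Set.mem_insert _ _, fun q _ hq => (hs q hq).le⟩
  have hnot (s : P) (hs : ∀ q, s ≤ q → q = s) : s ∉ X :=
    fun hsX => hmax s ⟨hsX, fun q _ hq => (hs q hq).le⟩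
  have hinter : insert t X ∩ insert t' X = X := by
    ext x
    simp only [Set.mem_inter_iff, Set.mem_insert_iff]
    constructor
    · rintro ⟨rfl | hx, rfl | hx'⟩ <;> first | assumption | exact absurd rfl hne
    · exact fun hx => ⟨Or.inr hx, Or.inr hx⟩
  obtain ⟨x, hx⟩ := h.maximality (insert t X) (insert t' X) (hinter.symm ▸ hX)
    ⟨t, hmem t ht⟩ ⟨t', hmem t' ht'⟩
  rw [hinter] at hx
  exact hmax x hx

theorem DualFinitenessAssumption.orderDual (h : DualFinitenessAssumption P) :
    FinitenessAssumption Pᵒᵈ where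
  nonempty := h.nonempty
  downset := h.upset
  maximality := h.minimality

/-- A presheaf of finite sets on a preordered set. -/
structure FinitePresheaf (P : Type*) [Preorder P] where
  /-- the values -/
  fiber : P → Type
  finite : ∀ p, Finite (fiber p)
  /-- the restriction maps -/
  res : ∀ {p q : P}, p ≤ q → fiber q → fiber p
  res_refl : ∀ {p : P} (i : fiber p), res le_rfl i = i
  res_res : ∀ {p q r : P} (hpq : p ≤ q) (hqr : q ≤ r) (i : fiber r),
    res hpq (res hqr i) = res (hpq.trans hqr) i

attribute [instance] FinitePresheaf.finite

/-- The property that no point of the fiber at `p` extends to all `q ≥ p`. -/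
def FinitePresheaf.NoExtension (I : FinitePresheaf P) (p : P) : Prop :=
  ∀ i : I.fiber p, ∃ (q : P) (hpq : p ≤ q), i ∉ Set.range (I.res hpq)

/-- The indicator presheaf of the elements that are not above `p`. -/
def notAbovePresheaf (p : P) : FinitePresheaf P where
  fiber q := PLift (¬ p ≤ q)
  finite _ := inferInstance
  res h i := ⟨fun hp => i.down (hp.trans h)⟩
  res_refl _ := rfl
  res_res _ _ _ := rfl

open Classical in
/-- The presheaf that has one point at each `q ≠ p`, and at `p` one point for each of the two parts
`U` and its complement of the elements above `p`. -/
def splittingPresheaf (p : P) (U : Set P)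
    (hU : ∀ q r, p < q → q ≤ r → (q ∈ U ↔ r ∈ U)) : FinitePresheaf P where
  fiber q := {b : Prop // q ≠ p → b = (q ∈ U)}
  finite _ := inferInstance
  res {q r} _ b := ⟨if q = p then b.1 else q ∈ U, fun hq => if_neg hq⟩
  res_refl {q} b := by
    apply Subtype.ext
    by_cases hq : q = p
    · exact if_pos hq
    · exact (if_neg hq).trans (b.2 hq).symm
  res_res {q r s} hqr hrs b := by
    apply Subtype.ext
    by_cases hq : q = p
    · subst hq
      by_cases hr : r = q
      · simp [hr]
      · have hlt : q < r := lt_of_le_of_ne hqr (Ne.symm hr)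
        simp only [if_true, if_neg hr]
        rw [b.2 (hlt.trans_le hrs).ne', hU r s hlt hrs]
    · simp [hq]

/-- Each of the two points over `p` is missed by restriction from the opposite side: from `v` or
from `u`. -/
theorem splittingPresheaf_noExtension (p : P) (U : Set P)
    (hU : ∀ q r, p < q → q ≤ r → (q ∈ U ↔ r ∈ U)) {u v : P} (hu : p < u) (huU : u ∈ U)
    (hv : p < v) (hvU : v ∉ U) : (splittingPresheaf p U hU).NoExtension p := by
  have key (q : P) (hq : p < q) (b : (splittingPresheaf p U hU).fiber p)
      (hb : b ∈ Set.range ((splittingPresheaf p U hU).res hq.le)) : b.1 ↔ q ∈ U := by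
    obtain ⟨c, rfl⟩ := hb
    exact (Eq.trans (if_pos rfl) (c.2 hq.ne')).to_iff
  intro b
  by_cases hb : b.1
  · exact ⟨v, hv.le, fun h => hvU ((key v hv b h).mp hb)⟩
  · exact ⟨u, hu.le, fun h => hb ((key u hu b h).mpr huU)⟩

variable {S : Type*} [PartialOrder S]

/-- Connectedness of the elements of `S` that `f` maps above `p`, without nonemptiness. -/
def ConnectedAbove (f : S → P) (p : P) : Prop :=
  ∀ U : Set S, (∃ s ∈ U, p ≤ f s) →
    (∀ s t, p ≤ f s → p ≤ f t → s ≤ t → (s ∈ U ↔ t ∈ U)) → ∀ t, p ≤ f t → t ∈ U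

/-- If `f` is not cofinal, or some element of `P` has a disconnected set of elements of `S` above
it, then some presheaf has one point at each `f s`, and a point without extensions only. -/
theorem exists_finitePresheaf (h : FinitenessAssumption P) (f : S → P)
    (hf : ∀ s t, s ≤ t ↔ f s ≤ f t) (hcon : ¬ ∀ p, (∃ s, p ≤ f s) ∧ ConnectedAbove f p) :
    ∃ I : FinitePresheaf P, (∀ s, Nonempty (Unique (I.fiber (f s)))) ∧
      ∃ p, I.NoExtension p := by
  by_cases hcof : ∀ p, ∃ s, p ≤ f s
  swap
  · obtain ⟨p, hp⟩ := not_forall.mp hcof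
    push Not at hp
    exact ⟨notAbovePresheaf p, fun s => ⟨⟨⟨⟨hp s⟩⟩, fun _ => rfl⟩⟩, p,
      fun i => absurd le_rfl i.down⟩
  replace hcon : {p | ¬ ConnectedAbove f p}.Nonempty := by
    by_contra hne
    refine hcon fun p => ⟨hcof p, ?_⟩
    by_contra hp
    exact hne ⟨p, hp⟩
  have hacc : ∀ X : Set P, X.Nonempty → ∃ x, Maximal (· ∈ X) x := by
    refine (exists_top_or_exists_maximal h).resolve_left ?_
    -- A top of `P` lies below some `f s₀`, so `s₀` is a top of `S` and connects everything.
    rintro ⟨t, ht⟩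
    obtain ⟨p, hp⟩ := hcon
    apply hp
    obtain ⟨s₀, hs₀⟩ := hcof t
    have hle (s : S) : s ≤ s₀ := (hf _ _).mpr ((ht _).trans hs₀)
    have hp₀ : p ≤ f s₀ := (ht p).trans hs₀
    rintro U ⟨s, hsU, hs⟩ hU r hr
    exact (hU r s₀ hr hp₀ (hle r)).mpr ((hU s s₀ hs hp₀ (hle s)).mp hsU)
  obtain ⟨p, hp, hmax⟩ := hacc _ hcon
  have hgt (q : P) (hq : p < q) : ConnectedAbove f q := by
    by_contra hqc
    exact hq.not_ge (hmax hqc hq.le)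
  -- If `p = f s`, then `s` is least among the elements mapped above `p`, which makes them
  -- connected.
  have hrange (s : S) : f s ≠ p := by
    rintro rfl
    apply hp
    rintro U ⟨r, hrU, hr⟩ hU t ht
    exact (hU s t le_rfl ht ((hf _ _).mpr ht)).mp ((hU s r le_rfl hr ((hf _ _).mpr hr)).mpr hrU)
  have hlt {s : S} (hs : p ≤ f s) : p < f s := lt_of_le_of_ne hs (hrange s).symm
  simp only [Set.mem_ofPred_eq, ConnectedAbove, not_forall] at hp
  obtain ⟨U, ⟨s, hsU, hs⟩, hU, t, ht, htU⟩ := hp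
  have hall {q : P} (hq : p < q) {r : S} (hr : r ∈ U) (hqr : q ≤ f r) (r' : S) (hqr' : q ≤ f r') :
      r' ∈ U :=
    hgt q hq U ⟨r, hr, hqr⟩ (fun a b ha hb => hU a b (hq.le.trans ha) (hq.le.trans hb)) r' hqr'
  -- For `q > p` all elements mapped above `q` lie on one side of `U`, and cofinality carries this
  -- side up to `r`.
  have hV : ∀ q r, p < q → q ≤ r →
      (q ∈ {q | ∃ s ∈ U, q ≤ f s} ↔ r ∈ {q | ∃ s ∈ U, q ≤ f s}) := by
    intro q r hq hqr
    constructor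
    · rintro ⟨a, haU, ha⟩
      obtain ⟨b, hb⟩ := hcof r
      exact ⟨b, hall hq haU ha b (hqr.trans hb), hb⟩
    · rintro ⟨a, haU, ha⟩
      exact ⟨a, haU, hqr.trans ha⟩
  refine ⟨splittingPresheaf p _ hV, fun a => ⟨⟨⟨⟨_, fun _ => rfl⟩⟩, fun b => ?_⟩⟩, p, ?_⟩
  · exact Subtype.ext (b.2 (hrange a))
  · refine splittingPresheaf_noExtension p _ hV (hlt hs) ⟨s, hsU, le_rfl⟩ (hlt ht) ?_
    rintro ⟨a, haU, ha⟩
    exact htU (hall (hlt ht) haU ha t le_rfl)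

end Order

/-! ### Test modules without `K_P` as a retract. -/

section TestModules

variable (K : Type w) [Field K] {P : Type u} [PartialOrder P]

/-- The module of `K`-valued functions on the fibers of a presheaf of finite sets. -/
def functionModule (I : FinitePresheaf P) : PfdModule K P where
  obj p := FGModuleCat.of K (I.fiber p → K)
  map g := FGModuleCat.ofHom (LinearMap.funLeft K K (I.res (leOfHom g)))
  map_id p := by
    apply FGModuleCat.hom_ext
    ext a i
    exact congrArg a (I.res_refl i)
  map_comp g g' := by
    apply FGModuleCat.hom_ext
    ext a i
    exact congrArg a (I.res_res _ _ i).symm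

/-- The free module on the fibers of a presheaf of finite sets on the dual order. -/
def freeModule (I : FinitePresheaf Pᵒᵈ) : PfdModule K P where
  obj p := FGModuleCat.of K (I.fiber (OrderDual.toDual p) →₀ K)
  map g := FGModuleCat.ofHom
    (Finsupp.lmapDomain K K (I.res (OrderDual.toDual_le_toDual.mpr (leOfHom g))))
  map_id p := by
    apply FGModuleCat.hom_ext
    refine LinearMap.ext fun a => ?_
    exact (congrArg (fun t => Finsupp.mapDomain t a) (funext fun i => I.res_refl i)).trans
      Finsupp.mapDomain_id
  map_comp g g' := by
    apply FGModuleCat.hom_ext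
    refine LinearMap.ext fun a => ?_
    refine Eq.trans ?_ Finsupp.mapDomain_comp
    exact congrArg (fun t => Finsupp.mapDomain t a) (funext fun i => (I.res_res _ _ i).symm)

theorem isEmpty_retract_functionModule (I : FinitePresheaf P) {p : P} (hp : I.NoExtension p) :
    IsEmpty (Retract (entireIntervalModule K P) (functionModule K I)) := by
  classical
  refine ⟨fun R => ?_⟩
  have hzero : appLinear R.r p = 0 := by
    apply LinearMap.pi_ext'
    intro i
    apply LinearMap.ext_ring
    obtain ⟨q, hpq, hi⟩ := hp i
    have h : appLinear R.r p (Pi.single i (1 : K)) =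
        appLinear R.r q (LinearMap.funLeft K K (I.res hpq) (Pi.single i (1 : K))) :=
      (appLinear_naturality R.r (homOfLE hpq) (Pi.single i (1 : K) : I.fiber p → K)).symm
    have h0 : LinearMap.funLeft K K (I.res hpq) (Pi.single i (1 : K)) = 0 := by
      funext j
      exact Pi.single_eq_of_ne (fun hj => hi ⟨j, hj⟩) 1
    refine h.trans ?_
    rw [h0]
    exact map_zero _
  have hone : appLinear R.r p (appLinear R.i p (1 : K)) = (1 : K) :=
    congrArg (fun f => appLinear f p (1 : K)) R.retract
  rw [hzero] at hone
  exact zero_ne_one (α := K) hone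

/-- Here the section vanishes: its value at `p` is pushed forward from every `q`, so each point has
coefficient 0. -/
theorem isEmpty_retract_freeModule (I : FinitePresheaf Pᵒᵈ) {p : Pᵒᵈ} (hp : I.NoExtension p) :
    IsEmpty (Retract (entireIntervalModule K P) (freeModule K I)) := by
  refine ⟨fun R => ?_⟩
  have hzero : appLinear R.i (OrderDual.ofDual p) (1 : K) = 0 := by
    refine Finsupp.ext fun i => ?_
    obtain ⟨q, hpq, hi⟩ := hp i
    have h : Finsupp.mapDomain (I.res hpq) (appLinear R.i (OrderDual.ofDual q) (1 : K)) =
        appLinear R.i (OrderDual.ofDual p) (1 : K) :=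
      (appLinear_naturality R.i (homOfLE hpq : OrderDual.ofDual q ⟶ OrderDual.ofDual p)
        (1 : K)).symm
    rw [← h]
    exact Finsupp.mapDomain_of_notMem_range _ i hi
  have hone : appLinear R.r (OrderDual.ofDual p) (appLinear R.i (OrderDual.ofDual p) (1 : K)) =
      (1 : K) :=
    congrArg (fun f => appLinear f (OrderDual.ofDual p) (1 : K)) R.retract
  rw [hzero] at hone
  exact zero_ne_one (α := K) ((map_zero _).symm.trans hone)

variable {S : Type v} [PartialOrder S] (F : S ⥤ P)

/-- A presheaf with one point at each object in the image of `F` has function module restricting to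
`K_S`. -/
def functionModuleIso (I : FinitePresheaf P) (h : ∀ s, Unique (I.fiber (F.obj s))) :
    F ⋙ functionModule K I ≅ entireIntervalModule K S :=
  NatIso.ofComponents
    (fun s => (LinearEquiv.funUnique (I.fiber (F.obj s)) K K).toFGModuleCatIso)
    (fun {s t} g => by
      apply FGModuleCat.hom_ext
      refine LinearMap.ext fun a => ?_
      exact congrArg a (Unique.eq_default (I.res (leOfHom (F.map g)) default)))

/-- A presheaf with one point at each object in the image of `F` has free module restricting to
`K_S`. -/
def freeModuleIso (I : FinitePresheaf Pᵒᵈ)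
    (h : ∀ s, Unique (I.fiber (OrderDual.toDual (F.obj s)))) :
    F ⋙ freeModule K I ≅ entireIntervalModule K S :=
  NatIso.ofComponents
    (fun s => (Finsupp.uniqueLinearEquiv K K
      (default : I.fiber (OrderDual.toDual (F.obj s)))).toFGModuleCatIso)
    (fun {s t} g => by
      apply FGModuleCat.hom_ext
      refine Finsupp.lhom_ext fun i b => ?_
      change Finsupp.mapDomain
        (I.res (OrderDual.toDual_le_toDual.mpr (leOfHom (F.map g)))) (Finsupp.single i b) (h t).default =
        Finsupp.single i b (h s).default
      rw [Finsupp.mapDomain_single, (h s).uniq i, (h t).uniq (I.res _ _), Finsupp.single_eq_same,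
        Finsupp.single_eq_same])

end TestModules

/-! ### Connected comma categories. -/

section Comma

variable {S P : Type*} [PartialOrder S] [PartialOrder P] (F : S ⥤ P)

theorem final_of_connectedAbove (h : ∀ p, (∃ s, p ≤ F.obj s) ∧ ConnectedAbove F.obj p) :
    F.Final where
  out p := by
    obtain ⟨⟨s₀, hs₀⟩, hconn⟩ := h p
    refine IsConnected.of_induct (j₀ := StructuredArrow.mk (homOfLE hs₀)) fun X h₀ hX j => ?_
    have := hconn {s | ∃ hs : p ≤ F.obj s, StructuredArrow.mk (homOfLE hs) ∈ X} ⟨s₀, ⟨hs₀, h₀⟩, hs₀⟩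
      (fun s t hs ht hst => by
        have := hX (StructuredArrow.homMk (homOfLE hst) (Subsingleton.elim _ _) :
          StructuredArrow.mk (homOfLE hs) ⟶ StructuredArrow.mk (homOfLE ht))
        exact ⟨fun ⟨_, h⟩ => ⟨ht, this.mp h⟩, fun ⟨_, h⟩ => ⟨hs, this.mpr h⟩⟩)
      j.right (leOfHom j.hom)
    obtain ⟨_, hj⟩ := this
    exact hj

theorem initial_of_connectedAbove
    (h : ∀ p, (∃ s : Sᵒᵈ, p ≤ OrderDual.toDual (F.obj (OrderDual.ofDual s))) ∧
      ConnectedAbove (fun s : Sᵒᵈ => OrderDual.toDual (F.obj (OrderDual.ofDual s))) p) :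
    F.Initial where
  out p := by
    obtain ⟨⟨s₀, hs₀⟩, hconn⟩ := h (OrderDual.toDual p)
    replace hs₀ : F.obj (OrderDual.ofDual s₀) ≤ p := hs₀
    refine IsConnected.of_induct (j₀ := CostructuredArrow.mk (homOfLE hs₀)) fun X h₀ hX j => ?_
    have := hconn {s | ∃ hs : F.obj (OrderDual.ofDual s) ≤ p,
        CostructuredArrow.mk (homOfLE hs) ∈ X} ⟨s₀, ⟨hs₀, h₀⟩, hs₀⟩
      (fun s t hs ht hst => by
        replace hs : F.obj (OrderDual.ofDual s) ≤ p := hs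
        replace ht : F.obj (OrderDual.ofDual t) ≤ p := ht
        have := hX (CostructuredArrow.homMk
          (homOfLE hst : OrderDual.ofDual t ⟶ OrderDual.ofDual s) (Subsingleton.elim _ _) :
          CostructuredArrow.mk (homOfLE ht) ⟶ CostructuredArrow.mk (homOfLE hs))
        exact ⟨fun ⟨_, h⟩ => ⟨ht, this.mpr h⟩, fun ⟨_, h⟩ => ⟨hs, this.mp h⟩⟩)
      (OrderDual.toDual j.left) (leOfHom j.hom)
    obtain ⟨_, hj⟩ := this
    exact hj

end Comma

/-- If multiplicities of the entire interval modules agree, then a module that restricts to `K_S`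
has `K_P` as a retract. -/
theorem nonempty_retract_of_restriction_iso {K : Type w} [Field K] {S : Type v} {P : Type u}
    [PartialOrder S] [PartialOrder P] [IsConnected S] {F : S ⥤ P} {M : PfdModule K P}
    (hM : mult M (entireIntervalModule K P) = mult (F ⋙ M) (entireIntervalModule K S))
    (e : F ⋙ M ≅ entireIntervalModule K S) :
    Nonempty (Retract (entireIntervalModule K P) M) :=
  nonempty_retract_of_mult_ne_zero (by rw [hM, mult_eq_one_of_iso e]; exact one_ne_zero)

end PersMod

end

theorem propositionD {K : Type*} [Field K] {S P : Type*} [PartialOrder S] [PartialOrder P]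
    (hS : CategoryTheory.IsConnected S) (hP : CategoryTheory.IsConnected P)
    (F : S ⥤ P) (hF : ∀ s t : S, s ≤ t ↔ F.obj s ≤ F.obj t)
    (hmult : ∀ M : PersMod.PfdModule K P,
      PersMod.mult M (PersMod.entireIntervalModule K P) =
        PersMod.mult (F ⋙ M) (PersMod.entireIntervalModule K S)) :
    (PersMod.FinitenessAssumption P → F.Final) ∧
      (PersMod.DualFinitenessAssumption P → F.Initial) := by
  refine ⟨fun h => PersMod.final_of_connectedAbove F ?_,
    fun h => PersMod.initial_of_connectedAbove F ?_⟩
  · by_contra hcon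
    obtain ⟨I, hI, p, hp⟩ := PersMod.exists_finitePresheaf h F.obj hF hcon
    obtain ⟨R⟩ := PersMod.nonempty_retract_of_restriction_iso (hmult _)
      (PersMod.functionModuleIso K F I fun s => (hI s).some)
    exact (PersMod.isEmpty_retract_functionModule K I hp).false R
  · by_contra hcon
    obtain ⟨I, hI, p, hp⟩ := PersMod.exists_finitePresheaf h.orderDual
      (fun s : Sᵒᵈ => OrderDual.toDual (F.obj (OrderDual.ofDual s))) (fun s t => hF _ _) hcon
    obtain ⟨R⟩ := PersMod.nonempty_retract_of_restriction_iso (hmult _)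
      (PersMod.freeModuleIso K F I fun s => (hI (OrderDual.toDual s)).some)
    exact (PersMod.isEmpty_retract_freeModule K I hp).false R
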